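/- Let $n,k,d$ be integers with $n\ge 2$, $1\le k\le n$, $1\le d\le n-1$, and let $c=\lfloor n/(n-d)\rfloor$. \emph{Families.} Split the nodes $1,\dots,n$ consecutively into $c$ complete families of $n-d$ nodes each, indexed $1,\dots,c$, and one (possibly empty) incomplete family of the remaining $n \bmod (n-d)$ nodes, with index $0$. The nodes of family $c$ that are not among $1,\dots,d$ get index $-c$ instead of $c$. Let $N_x$ be the set of nodes of index $x$. In the family repair (FR) scheme the helper set $D_i$ is $\{1,\dots,d\}$ if $i\in N_0$, and otherwise consists of all nodes outside the family of $i$. Let $\pi_f^*$ be the sequence obtained by writing the indices of the nodes $1,\dots,n$ column by column into a table with $n-d$ rows and $\lceil n/(n-d)\rceil$ columns and reading it row by row. For a sequence $\pi$, if the $i$-th entry is $0$, let $y_i(\pi)$ be the number of positive entries before it; otherwise let $y_i(\pi)$ be the number of earlier entries with a different absolute value. Put $\mathcal M=\sum_{i=1}^k (d-y_i(\pi_f^*))$. \emph{Code.} Let $G$ be the graph on the nodes with edge set $E=\bar E\cup\tilde E$, where $\bar E$ joins $i\in N_x$ and $j\in N_y$ whenever $|x|\ne|y|$ and $\{x,y\}\ne\{0,-c\}$,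 and $\tilde E$ joins every node of $N_0$ to every node of $N_{-c}$. A generalized fractional repetition code over a field assigns to each edge a packet, which is a linear combination of the $\mathcal M$ packets of the file. The packet of an edge of $\bar E$ is stored at both its ends, that of an edge of $\tilde E$ only at its end in $N_{-c}$. For a set of edges, let $a_u$ ($u\in N_0$) be the number of its edges at $u$ and $a_0$ the number of its edges that meet no vertex of $N_0$, and put $\mathsf{a.count}=a_0+\sum_{u\in N_0}\min(a_u,d)$. The code is required to satisfy: (Property 1) the packet of an edge $uw\in\tilde E$ with $u\in N_0$ is a linear combination of the packets of the edges of $\bar E$ at $u$; (Property 2) the file can be reconstructed from the packets of any set of edges with $\mathsf{a.count}\ge\mathcal M$. \emph{MBR point.} A pair $(\alpha,\beta)$ of nonnegative reals supports the file size $\mathcal M$ under the FR scheme if in every information flow graph of the FR scheme (for any finite failure history, with storage edges of capacity $\alpha$ and helper edges of capacity $\beta$) the minimum cut between the source and any data collector, attached to $k$ active nodes, is at least $\mathcal M$. The MBR point is the supporting pair with the smallest $\beta$ and, for that $\beta$, the smallest $\alpha$. \emph{Claim.} (i) For any $k$ nodes, the set of packets stored in these nodes has $\mathsf{a.count}\ge\mathcal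 M$. (ii) Hence, for every generalized fractional repetition code, the file can be reconstructed from the packets stored in any $k$ nodes. (iii) Every node stores exactly $d$ packets and has exactly $d$ helpers, itself not among them, and every node can be repaired exactly with the FR scheme: each helper in $D_i$ sends one packet, a linear combination of the packets it stores, and these $d$ packets determine everything node $i$ stored. (iv) $(\alpha,\beta)=(d,1)$ is the MBR point of the FR scheme for the file size $\mathcal M$. Thus the code achieves the FR MBR point with exact repair. -/

import Mathlib

open scoped ENNReal NNReal

/-! Nodes are numbered from `0`: node `v` here is node `v + 1` in one-based numbering. -/

namespace GFR

/-! ### Families and rotating family index permutation -/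

/-- The number `c = ⌊n / (n - d)⌋` of complete families. -/
def numComplete (n d : ℕ) : ℕ := n / (n - d)

/-- The family index of node `v`. The first `c * (n - d)` nodes form the complete families
`1, …, c`; the remaining nodes form the incomplete family `0`. The members of the last complete
family that are not among the first `d` nodes carry the index `-c`. -/
def familyIndex (n d v : ℕ) : ℤ :=
  if v < d then ((v / (n - d) + 1 : ℕ) : ℤ)
  else if v < numComplete n d * (n - d) then -(numComplete n d : ℤ)
  else 0

/-- The family index vector. -/
def familyIndexVector (n d : ℕ) : List ℤ := (List.range n).map (familyIndex n d)

/-- The rotating family index permutation: write the family index vector column by column into a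
table with `n - d` rows and `⌈n / (n - d)⌉` columns, and read the table row by row. -/
def rfip (n d : ℕ) : List ℤ :=
  (List.range (n - d)).flatMap fun row =>
    (List.range (n ⌈/⌉ (n - d))).filterMap fun col =>
      (familyIndexVector n d)[col * (n - d) + row]?

/-- `y_{i+1}(π)`: the coordinate `i` (counted from `0`) of `π` is compared with the earlier ones.
If it is `0`, count the earlier positive coordinates; otherwise count the earlier coordinates
with a different absolute value. -/
def yCount (π : List ℤ) (i : ℕ) : ℕ :=
  if π.getD i 0 = 0 then (π.take i).countP (fun t => decide (0 < t))
  else (π.take i).countP (fun t => decide (|t| ≠ |π.getD i 0|))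

/-- The file size `M = ∑_{i=1}^k (d - y_i(π_f^*))`, where `π_f^*` is the rotating family index
permutation. (One always has `y_i ≤ d`, so the subtraction does not truncate.) -/
def fileSize (n k d : ℕ) : ℕ := ∑ i ∈ Finset.range k, (d - yCount (rfip n d) i)

/-- The helper set of node `i` in the family repair scheme: the first `d` nodes if `i` belongs to
the incomplete family, and all nodes outside the family of `i` otherwise. -/
def helpers (n d : ℕ) (i : Fin n) : Finset (Fin n) :=
  if familyIndex n d i = 0 then Finset.univ.filter fun j => (j : ℕ) < d
  else Finset.univ.filter fun j => |familyIndex n d j| ≠ |familyIndex n d i|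

/-! ### The graph of the code -/

/-- The graph with edge set `Ē`. -/
def barGraph (n d : ℕ) : SimpleGraph (Fin n) :=
  SimpleGraph.fromRel fun i j =>
    |familyIndex n d i| ≠ |familyIndex n d j| ∧
      (familyIndex n d i, familyIndex n d j) ∉
        ({(0, -(numComplete n d : ℤ)), (-(numComplete n d : ℤ), 0)} : Finset (ℤ × ℤ))

instance (n d : ℕ) : DecidableRel (barGraph n d).Adj := by
  unfold barGraph; infer_instance

/-- The graph with edge set `Ẽ`. -/
def tildeGraph (n d : ℕ) : SimpleGraph (Fin n) :=
  SimpleGraph.fromRel fun i j =>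
    familyIndex n d i = 0 ∧ familyIndex n d j = -(numComplete n d : ℤ)

instance (n d : ℕ) : DecidableRel (tildeGraph n d).Adj := by
  unfold tildeGraph; infer_instance

/-- The edge set `E = Ē ∪ Ẽ`; every edge stands for one coded packet. -/
def edges (n d : ℕ) : Finset (Sym2 (Fin n)) :=
  (barGraph n d).edgeFinset ∪ (tildeGraph n d).edgeFinset

/-- The packets stored at node `i`: those of the edges of `Ē` at `i` and, if `i` has family index
`-c`, also those of the edges of `Ẽ` at `i`. -/
def storedAt (n d : ℕ) (i : Fin n) : Finset (Sym2 (Fin n)) :=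
  (barGraph n d).edgeFinset.filter (fun e => i ∈ e) ∪
    if familyIndex n d i = -(numComplete n d : ℤ) then
      (tildeGraph n d).edgeFinset.filter (fun e => i ∈ e)
    else ∅

/-- The packets stored in at least one of the nodes of `S`. -/
def storedIn (n d : ℕ) (S : Finset (Fin n)) : Finset (Sym2 (Fin n)) :=
  S.biUnion (storedAt n d)

/-- The incomplete family `N₀`. -/
def incomplete (n d : ℕ) : Finset (Fin n) :=
  Finset.univ.filter fun u => familyIndex n d u = 0

/-- `a.count` of a set `T` of packets (edges): `a₀ + ∑_{u ∈ N₀} min (a_u) d`, where `a_u` is the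
number of edges of `T` at `u`, and `a₀` the number of edges of `T` at no vertex of `N₀`. -/
def aCount (n d : ℕ) (T : Finset (Sym2 (Fin n))) : ℕ :=
  (T.filter fun e => ∀ u ∈ incomplete n d, u ∉ e).card +
    ∑ u ∈ incomplete n d, min (T.filter fun e => u ∈ e).card d

/-! ### The code -/

section Code

variable {F : Type*} [Field F] {n M : ℕ}

/-- The contents of the packets of `T` when the file is `x`, if `g e` is the coding vector of the
packet `e`. -/
def contents (g : Sym2 (Fin n) → Fin M → F) (T : Finset (Sym2 (Fin n))) (x : Fin M → F) :
    T → F :=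
  fun e => g e ⬝ᵥ x

/-- The file can be reconstructed from the packets of `T`. -/
def CanReconstruct (g : Sym2 (Fin n) → Fin M → F) (T : Finset (Sym2 (Fin n))) : Prop :=
  ∃ dec : (T → F) → (Fin M → F), ∀ x, dec (contents g T x) = x

/-- A generalized fractional repetition code over the field `F`: coding vectors for the packets
of the edges (the values of `coding` outside `edges n d` play no role) with the two defining
properties of the construction. -/
structure Code (F : Type*) [Field F] (n k d : ℕ) where
  /-- The coding vectors of the packets, for a file of `fileSize n k d` packets. -/
  coding : Sym2 (Fin n) → Fin (fileSize n k d) → F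
  /-- The packet of an edge `uw` of `Ẽ` with `u` in the incomplete family is a linear combination
  of the packets of the edges of `Ē` at `u`. -/
  property_one : ∀ u w : Fin n, familyIndex n d u = 0 →
    familyIndex n d w = -(numComplete n d : ℤ) →
    coding s(u, w) ∈ Submodule.span F {g | ∃ j, (barGraph n d).Adj j u ∧ g = coding s(j, u)}
  /-- The file can be reconstructed from every set of packets whose `a.count` is at least the
  file size. -/
  property_two : ∀ T ⊆ edges n d, fileSize n k d ≤ aCount n d T → CanReconstruct coding T

/-- Node `i` can be exactly repaired under the family repair scheme with `β = 1`: each helper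
sends one packet, a linear combination of the packets that it stores, and from the packets
received the newcomer recovers exactly what node `i` stored. -/
def ExactlyRepairable {k d : ℕ} (C : Code F n k d) (i : Fin n) : Prop :=
  ∃ (msg : ∀ j : helpers n d i, (storedAt n d j → F) →ₗ[F] F)
    (rep : (helpers n d i → F) →ₗ[F] (storedAt n d i → F)),
    ∀ x, rep (fun j => msg j (contents C.coding (storedAt n d j) x)) =
      contents C.coding (storedAt n d i) x

end Code

/-! ### Information flow graphs of stationary repair schemes -/

/-- An incarnation of a storage node: one of the `n` initial nodes, or the newcomer of one of the
`T` repairs. -/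
abbrev Incarnation (n T : ℕ) := Fin n ⊕ Fin T

/-- The vertices of the information flow graph. -/
inductive Vertex (n T : ℕ) where
  | source : Vertex n T
  | inp : Incarnation n T → Vertex n T
  | out : Incarnation n T → Vertex n T
  | sink : Vertex n T
  deriving DecidableEq, Fintype

section Flow

variable {n T : ℕ}

/-- The storage node of an incarnation, when node `h t` is the one that fails at step `t`. -/
def nodeOf (h : Fin T → Fin n) : Incarnation n T → Fin n
  | .inl i => i
  | .inr t => h t

/-- The number of failures up to and including the one that created the incarnation. -/
def birth : Incarnation n T → ℕ
  | .inl _ => 0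
  | .inr t => t + 1

/-- The incarnation `a` exists and has not failed after the first `t` failures. -/
def IsActive (h : Fin T → Fin n) (t : ℕ) (a : Incarnation n T) : Prop :=
  birth a ≤ t ∧ ∀ s : Fin T, birth a ≤ s → (s : ℕ) < t → h s ≠ nodeOf h a

open Classical in
/-- The edge capacities of the information flow graph of the stationary scheme with helper sets
`D` under the failure history `h`, with the data collector attached to the active incarnations of
the nodes of `S`. Capacity `0` means that there is no edge. -/
noncomputable def capacity (D : Fin n → Finset (Fin n)) (α β : ℝ≥0∞) (h : Fin T → Fin n)
    (S : Finset (Fin n)) : Vertex n T → Vertex n T → ℝ≥0∞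
  | .source, .inp (.inl _) => ⊤
  | .inp a, .out b => if a = b then α else 0
  | .out a, .inp (.inr t) => if nodeOf h a ∈ D (h t) ∧ IsActive h t a then β else 0
  | .out a, .sink => if nodeOf h a ∈ S ∧ IsActive h T a then ⊤ else 0
  | _, _ => 0

/-- The minimum cut value separating the source from the data collector. -/
noncomputable def minCut (D : Fin n → Finset (Fin n)) (α β : ℝ≥0∞) (h : Fin T → Fin n)
    (S : Finset (Fin n)) : ℝ≥0∞ :=
  ⨅ (U : Finset (Vertex n T)) (_ : Vertex.source ∈ U) (_ : Vertex.sink ∉ U),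
    ∑ u ∈ U, ∑ v ∈ Uᶜ, capacity D α β h S u v

end Flow

/-- The pair `(α, β)` supports the file size `M` under the family repair scheme: for all failure
histories and all data collectors (attached to `k` active nodes), the minimum cut is at least
`M`. -/
def Supports (n k d M : ℕ) (α β : ℝ≥0) : Prop :=
  ∀ (T : ℕ) (h : Fin T → Fin n) (S : Finset (Fin n)), S.card = k →
    (M : ℝ≥0∞) ≤ minCut (helpers n d) α β h S

/-- `(α, β)` is the minimum-bandwidth regenerating point of the storage-bandwidth tradeoff of the
family repair scheme for the file size `M`: `β` is the smallest possible, and `α` is the smallest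
possible for this `β`. -/
def IsMBRPoint (n k d M : ℕ) (α β : ℝ≥0) : Prop :=
  Supports n k d M α β ∧
    ∀ α' β' : ℝ≥0, Supports n k d M α' β' → β ≤ β' ∧ (β' = β → α ≤ α')

end GFR

/-! Number nodes from `0`. A family is then a column, i.e. a value of `v / (n - d)`, and node `i`
stores exactly the edges joining it to its helpers. Along the reading order, `y` counts the earlier
nodes that help the current one.

One extremal inequality carries both reconstruction and the cut bound. For any node set `A`, the
number of pairs in `A` from different families is at most the sum of the first `|A|` values of `y`
(`crossPairs_le_sum_yCount`). The reason is that position `i` lies in some row `ρ`, and at most `i`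
nodes lie in earlier rows, so a set of `i + 1` nodes meets some family more than `ρ` times. Deleting
a node of that family loses at most `i - ρ ≤ y` pairs. Hence `fileSize` at `|A|` plus the pairs of
`A` is at most `|A| * d` (`fileSize_add_crossPairs_le`).

For reconstruction, the nodes of `S` hold `|S| * d` packets with multiplicity, the repetitions being
pairs across families; the truncation at `d` in `aCount` is handled by adding all of `N₀` to `S`
when it bites (`fileSize_le_aCount`). For a finite cut, `A` is the set of nodes with some output on
the sink side. The first such incarnation of each node receives `d` minus the helpers already on
that side, which are again pairs across families (`supports_fileSize`). Optimality comes from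
letting the first `k` nodes of the reading order fail in turn (`isMBRPoint`). Repair sends along
each helper edge its own packet; Property 1 is needed only when a node of `N₀` helps one of `N₋c`.
-/

namespace GFR

/-! ### Families as columns: quotients and remainders modulo `n - d` -/

section Arithmetic

variable {n d v w : ℕ}

theorem numComplete_pos (hd : d < n) : 0 < numComplete n d :=
  Nat.div_pos (Nat.sub_le n d) (by omega)

theorem numComplete_mul_add (n d : ℕ) : numComplete n d * (n - d) + n % (n - d) = n :=
  Nat.div_add_mod' n (n - d)

theorem mod_lt_rows (hd : d < n) : n % (n - d) < n - d := Nat.mod_lt _ (by omega)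

theorem le_numComplete_mul (hd : d < n) : d ≤ numComplete n d * (n - d) := by
  have := numComplete_mul_add n d
  have := mod_lt_rows hd
  omega

theorem familyIndex_pos_iff (hd : d < n) : 0 < familyIndex n d v ↔ v < d := by
  have := numComplete_pos hd
  unfold familyIndex
  split_ifs with h1 h2
  · simp only [h1, iff_true]; positivity
  · simp only [h1, iff_false]; omega
  · simp [h1]

theorem familyIndex_eq_zero_iff (hd : d < n) :
    familyIndex n d v = 0 ↔ numComplete n d * (n - d) ≤ v := by
  have := numComplete_pos hd
  have := le_numComplete_mul hd
  unfold familyIndex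
  split_ifs with h1 h2
  · constructor
    · intro h; exact absurd h (by positivity)
    · omega
  · omega
  · omega

theorem familyIndex_eq_neg_iff (hd : d < n) :
    familyIndex n d v = -(numComplete n d : ℤ) ↔ d ≤ v ∧ v < numComplete n d * (n - d) := by
  have := numComplete_pos hd
  have := le_numComplete_mul hd
  unfold familyIndex
  generalize v / (n - d) = q
  split_ifs with h1 h2 <;> omega

theorem div_eq_numComplete_iff (hd : d < n) (hv : v < n) :
    v / (n - d) = numComplete n d ↔ numComplete n d * (n - d) ≤ v := by
  have h1 := numComplete_mul_add n d
  have h2 := mod_lt_rows hd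
  rw [Nat.div_eq_iff (by omega)]
  constructor
  · rintro ⟨h, -⟩; exact h
  · intro h
    refine ⟨h, ?_⟩
    omega

theorem div_le_numComplete (hv : v < n) : v / (n - d) ≤ numComplete n d :=
  Nat.div_le_div_right hv.le

theorem le_of_div_add_one_eq (hd : d < n) (h1 : d ≤ v) (h2 : v < numComplete n d * (n - d)) :
    v / (n - d) + 1 = numComplete n d := by
  have h3 := numComplete_mul_add n d
  have h4 := mod_lt_rows hd
  have h5 := numComplete_pos hd
  obtain ⟨c, hc⟩ : ∃ c, numComplete n d = c + 1 := ⟨numComplete n d - 1, by omega⟩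
  rw [hc, add_mul, one_mul] at h2 h3
  rw [hc, Nat.add_right_cancel_iff, Nat.div_eq_iff (by omega)]
  omega

theorem abs_familyIndex (hd : d < n) (hv : v < n) :
    |familyIndex n d v| =
      if v / (n - d) = numComplete n d then 0 else ((v / (n - d) + 1 : ℕ) : ℤ) := by
  have h5 := numComplete_pos hd
  have h6 := le_numComplete_mul hd
  have h7 := div_eq_numComplete_iff hd hv
  have h8 := @le_of_div_add_one_eq n d v hd
  unfold familyIndex
  split_ifs with a b h h
  · omega
  · rw [Nat.abs_cast]
  · omega
  · rw [abs_neg, Nat.abs_cast, h8 (by omega) (by assumption)]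
  · simp
  · omega

theorem abs_familyIndex_eq_iff (hd : d < n) (hv : v < n) (hw : w < n) :
    |familyIndex n d v| = |familyIndex n d w| ↔ v / (n - d) = w / (n - d) := by
  rw [abs_familyIndex hd hv, abs_familyIndex hd hw]
  have h1 := div_le_numComplete (d := d) hv
  have h2 := div_le_numComplete (d := d) hw
  generalize v / (n - d) = a at *
  generalize w / (n - d) = b at *
  split_ifs <;> omega

/-- Together with `le_mod_of_negative`, this puts the incomplete column strictly above all nodes of
index `-c`, so none of the latter precedes a node of `N₀` in the reading order. -/
theorem mod_lt_of_incomplete (hd : d < n) (hv : v < n) (h : numComplete n d * (n - d) ≤ v) :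
    v % (n - d) < n % (n - d) := by
  have h1 := numComplete_mul_add n d
  have h2 := (div_eq_numComplete_iff hd hv).2 h
  have h3 := Nat.div_add_mod' v (n - d)
  rw [h2] at h3
  omega

theorem le_mod_of_negative (hd : d < n) (h1 : d ≤ v) (h2 : v < numComplete n d * (n - d)) :
    n % (n - d) ≤ v % (n - d) := by
  have h3 := numComplete_mul_add n d
  have h4 := le_of_div_add_one_eq hd h1 h2
  have h5 := Nat.div_add_mod' v (n - d)
  rw [← h4, add_mul, one_mul] at h3
  omega

theorem card_filter_div_eq (hd : d < n) {q : ℕ} (hq : q < numComplete n d) :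
    (Finset.univ.filter fun j : Fin n => (j : ℕ) / (n - d) = q).card = n - d := by
  have h1 := numComplete_mul_add n d
  have h2 : (q + 1) * (n - d) ≤ numComplete n d * (n - d) := Nat.mul_le_mul_right _ hq
  rw [add_mul, one_mul] at h2
  trans (Finset.Ico (q * (n - d)) (q * (n - d) + (n - d))).card
  swap
  · rw [Nat.card_Ico]; omega
  rw [← Finset.card_map Fin.valEmbedding]
  congr 1
  ext x
  simp only [Finset.mem_map, Finset.mem_filter, Finset.mem_univ, true_and, Fin.valEmbedding_apply,
    Finset.mem_Ico]
  constructor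
  · rintro ⟨y, hy, rfl⟩
    rw [Nat.div_eq_iff (by omega)] at hy
    omega
  · intro hx
    refine ⟨⟨x, by omega⟩, ?_, rfl⟩
    rw [Nat.div_eq_iff (by omega)]
    simp only
    omega

end Arithmetic

/-! ### Helper sets and stored packets -/

section Helpers

variable {n d : ℕ}

theorem mem_helpers_iff (hd : d < n) {i j : Fin n} :
    j ∈ helpers n d i ↔
      (j : ℕ) / (n - d) ≠ (i : ℕ) / (n - d) ∧
        (numComplete n d * (n - d) ≤ (i : ℕ) → (j : ℕ) < d) := by
  have h0 := le_numComplete_mul hd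
  unfold helpers
  split_ifs with h
  · rw [familyIndex_eq_zero_iff hd] at h
    simp only [Finset.mem_filter, Finset.mem_univ, true_and, h, forall_const, iff_and_self]
    have h1 := (div_eq_numComplete_iff hd i.2).2 h
    have h2 := div_eq_numComplete_iff hd j.2
    omega
  · rw [familyIndex_eq_zero_iff hd] at h
    simp [h, abs_familyIndex_eq_iff hd j.2 i.2]

theorem card_helpers (hd : d < n) (i : Fin n) : (helpers n d i).card = d := by
  by_cases h : numComplete n d * (n - d) ≤ (i : ℕ)
  · rw [helpers, if_pos ((familyIndex_eq_zero_iff hd).2 h), Fin.card_filter_val_lt]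
    omega
  · have h1 := div_eq_numComplete_iff hd i.2
    have h2 := div_le_numComplete (d := d) i.2
    have h3 := card_filter_div_eq hd (q := (i : ℕ) / (n - d)) (by omega)
    have h4 : helpers n d i =
        (Finset.univ.filter fun j : Fin n => (j : ℕ) / (n - d) = (i : ℕ) / (n - d))ᶜ := by
      ext j
      simp [mem_helpers_iff hd, h]
    rw [h4, Finset.card_compl, h3, Fintype.card_fin]
    omega

theorem self_notMem_helpers (hd : d < n) (i : Fin n) : i ∉ helpers n d i := by
  simp [mem_helpers_iff hd]

/-- The index pair `{0, -c}` removed from `Ē` is the only one for which helping is one-sided. -/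
theorem barGraph_adj_iff (hd : d < n) {i j : Fin n} :
    (barGraph n d).Adj i j ↔ j ∈ helpers n d i ∧ i ∈ helpers n d j := by
  have h0 := le_numComplete_mul hd
  have hi := div_eq_numComplete_iff hd i.2
  have hj := div_eq_numComplete_iff hd j.2
  have hni := @le_of_div_add_one_eq n d i hd
  have hnj := @le_of_div_add_one_eq n d j hd
  have hne : i ≠ j ↔ (i : ℕ) ≠ j := by rw [Ne, Fin.ext_iff]
  simp only [barGraph, SimpleGraph.fromRel_adj, ne_eq, abs_familyIndex_eq_iff hd i.2 j.2,
    abs_familyIndex_eq_iff hd j.2 i.2,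
    Finset.mem_insert, Finset.mem_singleton, Prod.mk.injEq, familyIndex_eq_zero_iff hd,
    familyIndex_eq_neg_iff hd, mem_helpers_iff hd, Fin.ext_iff]
  by_cases hij : (i : ℕ) = j
  · simp [hij]
  · simp only [hij, not_false_eq_true, true_and]
    grind

theorem tildeGraph_adj_iff (hd : d < n) {i j : Fin n} :
    (tildeGraph n d).Adj i j ↔
      (numComplete n d * (n - d) ≤ (i : ℕ) ∧ d ≤ (j : ℕ) ∧ (j : ℕ) < numComplete n d * (n - d)) ∨
      (numComplete n d * (n - d) ≤ (j : ℕ) ∧ d ≤ (i : ℕ) ∧ (i : ℕ) < numComplete n d * (n - d)) := by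
  simp only [tildeGraph, SimpleGraph.fromRel_adj, ne_eq, familyIndex_eq_zero_iff hd,
    familyIndex_eq_neg_iff hd, Fin.ext_iff]
  omega

/-- An edge of `Ẽ` is stored only at its end of index `-c`, the only end that the other one helps.
-/
theorem storedAt_eq (hd : d < n) (i : Fin n) :
    storedAt n d i = (helpers n d i).image fun j => s(i, j) := by
  have h0 := le_numComplete_mul hd
  have hi := div_eq_numComplete_iff hd i.2
  ext e
  simp only [storedAt, Finset.mem_union, Finset.mem_filter, SimpleGraph.mem_edgeFinset,
    Finset.mem_image, familyIndex_eq_neg_iff hd]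
  constructor
  · rintro (⟨he, hm⟩ | h)
    · obtain ⟨j, rfl⟩ := hm
      exact ⟨j, ((barGraph_adj_iff hd).1 he).1, rfl⟩
    · split_ifs at h with hh
      · obtain ⟨he, hm⟩ := by simpa using h
        obtain ⟨j, rfl⟩ := hm
        have := (tildeGraph_adj_iff hd).1 he
        have hj := div_eq_numComplete_iff hd j.2
        exact ⟨j, (mem_helpers_iff hd).2 (by dsimp only at this; omega), rfl⟩
      · simp at h
  · rintro ⟨j, hj, rfl⟩
    by_cases hh : (barGraph n d).Adj i j
    · exact Or.inl ⟨hh, by simp⟩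
    · right
      rw [barGraph_adj_iff hd] at hh
      simp only [hj, true_and] at hh
      have hj' := div_eq_numComplete_iff hd j.2
      rw [mem_helpers_iff hd] at hj hh
      -- If `j` helps `i` but not conversely, then `j` is incomplete and `i` has index `-c`.
      have : d ≤ (i : ℕ) ∧ (i : ℕ) < numComplete n d * (n - d) := by omega
      rw [if_pos this]
      simp only [Finset.mem_filter, SimpleGraph.mem_edgeFinset, SimpleGraph.mem_edgeSet,
        tildeGraph_adj_iff hd]
      refine ⟨?_, by simp⟩
      omega

theorem card_storedAt (hd : d < n) (i : Fin n) : (storedAt n d i).card = d := by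
  rw [storedAt_eq hd, Finset.card_image_of_injective _ fun a b h => Sym2.congr_right.1 h,
    card_helpers hd]

theorem storedIn_subset_edges (n d : ℕ) (S : Finset (Fin n)) : storedIn n d S ⊆ edges n d := by
  intro e he
  simp only [storedIn, Finset.mem_biUnion, storedAt, Finset.mem_union] at he
  obtain ⟨i, -, h | h⟩ := he
  · exact Finset.mem_union_left _ (Finset.mem_filter.1 h).1
  · split_ifs at h with hh
    · exact Finset.mem_union_right _ (Finset.mem_filter.1 h).1
    · simp at h

end Helpers

/-! ### Exact repair -/

section Repair

variable {F : Type*} [Field F] {n k d : ℕ}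

/-- Each packet that a node stores is a linear function of the contents of the helper sharing it. -/
theorem exists_message (hd : d < n) (C : Code F n k d) {i j : Fin n} (hj : j ∈ helpers n d i) :
    ∃ msg : (storedAt n d j → F) →ₗ[F] F,
      ∀ x, msg (contents C.coding (storedAt n d j) x) = C.coding s(i, j) ⬝ᵥ x := by
  have h0 := le_numComplete_mul hd
  have read : ∀ a, a ∈ helpers n d j → ∃ msg : (storedAt n d j → F) →ₗ[F] F,
      ∀ x, msg (contents C.coding (storedAt n d j) x) = C.coding s(a, j) ⬝ᵥ x := by
    intro a ha
    have hm : s(a, j) ∈ storedAt n d j := by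
      rw [storedAt_eq hd, Sym2.eq_swap]
      exact Finset.mem_image_of_mem _ ha
    exact ⟨LinearMap.proj ⟨s(a, j), hm⟩, fun x => rfl⟩
  by_cases hi : i ∈ helpers n d j
  · exact read i hi
  -- Here `j` lies in `N₀` and does not store the packet of `s(i, j)`; Property 1 puts it in the
  -- span of the packets that `j` does store, and the message is built along that span.
  · have hi' := div_eq_numComplete_iff hd i.2
    rw [mem_helpers_iff hd] at hi hj
    have hspan := C.property_one j i ((familyIndex_eq_zero_iff hd).2 (by omega))
      ((familyIndex_eq_neg_iff hd).2 (by omega))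
    rw [Sym2.eq_swap]
    generalize C.coding s(j, i) = g at hspan
    induction hspan using Submodule.span_induction with
    | mem g hg =>
      obtain ⟨a, ha, rfl⟩ := hg
      exact read a ((barGraph_adj_iff hd).1 ha).2
    | zero => exact ⟨0, fun x => by simp⟩
    | add g g' _ _ hg hg' =>
      obtain ⟨f, hf⟩ := hg
      obtain ⟨f', hf'⟩ := hg'
      exact ⟨f + f', fun x => by simp [hf, hf', add_dotProduct]⟩
    | smul r g _ hg =>
      obtain ⟨f, hf⟩ := hg
      exact ⟨r • f, fun x => by simp [hf, smul_dotProduct]⟩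

theorem exactlyRepairable (hd : d < n) (C : Code F n k d) (i : Fin n) :
    ExactlyRepairable C i := by
  choose msg hmsg using fun j : helpers n d i => exists_message hd C j.2
  have hex : ∀ e : storedAt n d i, ∃ j : helpers n d i, s(i, (j : Fin n)) = e := by
    rintro ⟨e, he⟩
    rw [storedAt_eq hd, Finset.mem_image] at he
    obtain ⟨j, hj, rfl⟩ := he
    exact ⟨⟨j, hj⟩, rfl⟩
  choose end' hend using hex
  refine ⟨msg, LinearMap.funLeft F F end', fun x => ?_⟩
  ext e
  rw [LinearMap.funLeft_apply, hmsg, hend]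
  rfl

end Repair

/-! ### The reading order and the meaning of `y` -/

section ReadingOrder

variable {n d : ℕ}

/-- The nodes in the order in which the rotating family index permutation lists their indices. -/
def readingOrder (n d : ℕ) : List ℕ :=
  (List.range (n - d)).flatMap fun row =>
    ((List.range (n ⌈/⌉ (n - d))).map fun col => col * (n - d) + row).filter fun v => v < n

theorem rfip_eq_map_readingOrder (n d : ℕ) :
    rfip n d = (readingOrder n d).map (familyIndex n d) := by
  unfold rfip readingOrder
  rw [List.map_flatMap]
  congr 1
  ext1 row
  rw [← List.filterMap_eq_filter, List.filterMap_map, List.map_filterMap]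
  congr 1
  ext1 col
  simp only [familyIndexVector, List.getElem?_map, Function.comp, Option.guard]
  by_cases h : col * (n - d) + row < n <;> simp [h]

theorem mem_readingOrder (hd : d < n) {v : ℕ} : v ∈ readingOrder n d ↔ v < n := by
  simp only [readingOrder, List.mem_flatMap, List.mem_range, List.mem_filter, List.mem_map,
    decide_eq_true_eq]
  constructor
  · rintro ⟨_, _, _, h⟩; exact h
  · intro h
    have hm : 0 < n - d := by omega
    refine ⟨v % (n - d), Nat.mod_lt _ hm, ⟨v / (n - d), ?_, Nat.div_add_mod' _ _⟩, h⟩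
    by_contra! h'
    rw [ceilDiv_le_iff_le_mul hm] at h'
    have := Nat.mul_div_le v (n - d)
    omega

theorem mul_add_mod_and_div {m row col : ℕ} (h : row < m) :
    (col * m + row) % m = row ∧ (col * m + row) / m = col := by
  constructor
  · rw [mul_comm, Nat.mul_add_mod, Nat.mod_eq_of_lt h]
  · rw [mul_comm, Nat.mul_add_div (by omega), Nat.div_eq_of_lt h, add_zero]

theorem pairwise_readingOrder (n d : ℕ) :
    (readingOrder n d).Pairwise fun v w =>
      v % (n - d) < w % (n - d) ∨ v % (n - d) = w % (n - d) ∧ v / (n - d) < w / (n - d) := by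
  unfold readingOrder
  rw [List.pairwise_flatMap]
  constructor
  · intro row hrow
    rw [List.mem_range] at hrow
    refine List.Pairwise.filter _ (List.pairwise_map.2 (List.pairwise_lt_range.imp ?_))
    intro a b hab
    rw [(mul_add_mod_and_div hrow).1, (mul_add_mod_and_div hrow).1, (mul_add_mod_and_div hrow).2,
      (mul_add_mod_and_div hrow).2]
    exact Or.inr ⟨rfl, hab⟩
  · refine List.pairwise_lt_range.imp_of_mem ?_
    intro a b ha hb hab x hx y hy
    rw [List.mem_range] at ha hb
    obtain ⟨_, -, rfl⟩ := List.mem_map.1 (List.mem_filter.1 hx).1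
    obtain ⟨_, -, rfl⟩ := List.mem_map.1 (List.mem_filter.1 hy).1
    left
    rw [(mul_add_mod_and_div ha).1, (mul_add_mod_and_div hb).1]
    exact hab

theorem nodup_readingOrder (n d : ℕ) : (readingOrder n d).Nodup :=
  (pairwise_readingOrder n d).imp fun h e => by subst e; omega

theorem length_readingOrder (hd : d < n) : (readingOrder n d).length = n := by
  rw [← List.toFinset_card_of_nodup (nodup_readingOrder n d)]
  conv_rhs => rw [← Finset.card_range n]
  congr 1
  ext v
  simp [mem_readingOrder hd]

theorem countP_take_eq_card {α : Type*} (p : α → Bool) {l : List α} (hl : l.length = n) {i : ℕ}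
    (hi : i ≤ n) :
    (l.take i).countP p =
      (Finset.univ.filter fun j : Fin n => (j : ℕ) < i ∧ p (l[(j : ℕ)]'(by omega))).card := by
  induction i with
  | zero => simp
  | succ i ih =>
    have hil : i < l.length := by omega
    rw [List.take_succ_eq_append_getElem hil, List.countP_append, ih (by omega),
      List.countP_singleton]
    split_ifs with h
    · rw [← Finset.card_insert_of_notMem (a := (⟨i, by omega⟩ : Fin n)) (by simp)]
      congr 1
      ext j
      simp only [Finset.mem_insert, Finset.mem_filter, Finset.mem_univ, true_and, Fin.ext_iff]
      constructor
      · rintro (h' | ⟨h', h''⟩)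
        · simp [h', h]
        · exact ⟨by omega, h''⟩
      · rintro ⟨h', h''⟩
        by_cases hj : (j : ℕ) = i
        · exact Or.inl hj
        · exact Or.inr ⟨by omega, h''⟩
    · rw [add_zero]
      congr 1
      ext j
      simp only [Finset.mem_filter, Finset.mem_univ, true_and]
      constructor
      · rintro ⟨h', h''⟩
        exact ⟨by omega, h''⟩
      · rintro ⟨h', h''⟩
        refine ⟨?_, h''⟩
        by_contra hj
        obtain rfl : (j : ℕ) = i := by omega
        exact h h''

/-- The node at a given position of the reading order. -/
def nodeAt (hd : d < n) (i : Fin n) : Fin n :=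
  ⟨(readingOrder n d)[(i : ℕ)]'(by rw [length_readingOrder hd]; exact i.2),
    (mem_readingOrder hd).1 (List.getElem_mem _)⟩

theorem nodeAt_lex (hd : d < n) {i j : Fin n} (h : i < j) :
    (nodeAt hd i : ℕ) % (n - d) < (nodeAt hd j : ℕ) % (n - d) ∨
      (nodeAt hd i : ℕ) % (n - d) = (nodeAt hd j : ℕ) % (n - d) ∧
        (nodeAt hd i : ℕ) / (n - d) < (nodeAt hd j : ℕ) / (n - d) :=
  List.pairwise_iff_getElem.1 (pairwise_readingOrder n d) i j _ _ h

theorem nodeAt_injective (hd : d < n) : Function.Injective (nodeAt hd) := by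
  intro i j h
  rcases lt_trichotomy i j with hij | hij | hij
  · have := nodeAt_lex hd hij
    rw [h] at this
    omega
  · exact hij
  · have := nodeAt_lex hd hij
    rw [h] at this
    omega

theorem nodeAt_surjective (hd : d < n) : Function.Surjective (nodeAt hd) :=
  Finite.surjective_of_injective (nodeAt_injective hd)

/-- Both branches of `yCount` mirror those of `helpers`: a positive index means being among the
first `d` nodes, and a different absolute value means another family. -/
theorem yCount_rfip (hd : d < n) (i : Fin n) :
    yCount (rfip n d) i =
      (Finset.univ.filter fun j => j < i ∧ nodeAt hd j ∈ helpers n d (nodeAt hd i)).card := by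
  have hl := length_readingOrder hd
  have hi : (i : ℕ) < (readingOrder n d).length := by rw [hl]; exact i.2
  have hget : (rfip n d).getD i 0 = familyIndex n d (nodeAt hd i) := by
    rw [rfip_eq_map_readingOrder, List.getD_eq_getElem _ _ (by simpa using hi), List.getElem_map]
    rfl
  unfold yCount
  rw [hget, rfip_eq_map_readingOrder, ← List.map_take, List.countP_map, List.countP_map,
    countP_take_eq_card _ hl i.2.le, countP_take_eq_card _ hl i.2.le]
  unfold helpers
  split_ifs with h
  · congr 1
    ext j
    simp [familyIndex_pos_iff hd, nodeAt]
  · congr 1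
    ext j
    simp only [Finset.mem_filter, Finset.mem_univ, true_and, Function.comp, decide_eq_true_eq]
    rfl

/-- The extra condition for a node of `N₀`, that its helper be among the first `d`, is automatic
here: nodes of index `-c` lie in later rows. -/
theorem mem_helpers_nodeAt_iff (hd : d < n) {i j : Fin n} (h : j < i) :
    nodeAt hd j ∈ helpers n d (nodeAt hd i) ↔
      (nodeAt hd j : ℕ) / (n - d) ≠ (nodeAt hd i : ℕ) / (n - d) := by
  rw [mem_helpers_iff hd, and_iff_left_iff_imp]
  intro hne hi
  by_contra! hj
  have h1 := (div_eq_numComplete_iff hd (nodeAt hd i).2).2 hi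
  have h2 := div_eq_numComplete_iff hd (nodeAt hd j).2
  have h3 := le_mod_of_negative hd hj (by omega)
  have h4 := mod_lt_of_incomplete hd (nodeAt hd i).2 hi
  have h5 := nodeAt_lex hd h
  omega

/-- The earlier nodes not counted by `y` lie in the same column, hence in distinct smaller rows. -/
theorem le_yCount_add_row (hd : d < n) (i : Fin n) :
    (i : ℕ) ≤ yCount (rfip n d) i + (nodeAt hd i : ℕ) % (n - d) := by
  rw [yCount_rfip hd]
  have h1 : (Finset.univ.filter fun j : Fin n => j < i ∧
      ¬ nodeAt hd j ∈ helpers n d (nodeAt hd i)).card ≤ (nodeAt hd i : ℕ) % (n - d) := by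
    conv_rhs => rw [← Finset.card_range ((nodeAt hd i : ℕ) % (n - d))]
    refine Finset.card_le_card_of_injOn (fun j => (nodeAt hd j : ℕ) % (n - d)) ?_ ?_
    · intro j hj
      obtain ⟨hj1, hj2⟩ : j < i ∧ _ := by simpa using hj
      rw [mem_helpers_nodeAt_iff hd hj1] at hj2
      have := nodeAt_lex hd hj1
      simp only [Finset.coe_range, Set.mem_Iio]
      omega
    · intro j hj j' hj' e
      obtain ⟨hj1, hj2⟩ : j < i ∧ _ := by simpa using hj
      obtain ⟨hj3, hj4⟩ : j' < i ∧ _ := by simpa using hj'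
      rw [mem_helpers_nodeAt_iff hd hj1] at hj2
      rw [mem_helpers_nodeAt_iff hd hj3] at hj4
      refine nodeAt_injective hd (Fin.ext ?_)
      dsimp only at e
      rw [← Nat.div_add_mod' (nodeAt hd j : ℕ) (n - d), e, not_not.1 hj2, ← not_not.1 hj4,
        Nat.div_add_mod']
  have h2 := Finset.card_filter_add_card_filter_not (s := Finset.univ.filter fun j : Fin n => j < i)
    (fun j => nodeAt hd j ∈ helpers n d (nodeAt hd i))
  rw [Finset.filter_filter, Finset.filter_filter] at h2
  have h3 : (Finset.univ.filter fun j : Fin n => j < i).card = i := by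
    rw [Finset.filter_gt_eq_Iio, Fin.card_Iio]
  omega

theorem card_filter_mod_lt_row_le (hd : d < n) (i : Fin n) :
    (Finset.univ.filter fun v : Fin n =>
      (v : ℕ) % (n - d) < (nodeAt hd i : ℕ) % (n - d)).card ≤ i := by
  have h3 : ((Finset.univ.filter fun j : Fin n => j < i).image (nodeAt hd)).card = i := by
    rw [Finset.card_image_of_injective _ (nodeAt_injective hd), Finset.filter_gt_eq_Iio,
      Fin.card_Iio]
  conv_rhs => rw [← h3]
  refine Finset.card_le_card fun v hv => ?_
  simp only [Finset.mem_filter, Finset.mem_univ, true_and] at hv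
  obtain ⟨j, rfl⟩ := nodeAt_surjective hd v
  refine Finset.mem_image_of_mem _ (Finset.mem_filter.2 ⟨Finset.mem_univ _, ?_⟩)
  by_contra! hj
  rcases hj.lt_or_eq with hj | rfl
  · have := nodeAt_lex hd hj
    omega
  · omega

theorem yCount_le (hd : d < n) (i : Fin n) : yCount (rfip n d) i ≤ d := by
  rw [yCount_rfip hd]
  refine le_of_le_of_eq ?_ (card_helpers hd (nodeAt hd i))
  refine Finset.card_le_card_of_injOn (nodeAt hd) ?_ (nodeAt_injective hd).injOn
  intro j hj
  exact (Finset.mem_filter.1 hj).2.2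

end ReadingOrder

/-! ### The extremal inequality for pairs across families -/

section Extremal

variable {n d : ℕ}

/-- Any set of `i + 1` nodes meets some family in more nodes than the row of position `i`. -/
theorem exists_family_gt_row (hd : d < n) {A : Finset (Fin n)} {i : Fin n}
    (hA : A.card = (i : ℕ) + 1) :
    ∃ v ∈ A, (nodeAt hd i : ℕ) % (n - d) <
      (A.filter fun w : Fin n => (w : ℕ) / (n - d) = (v : ℕ) / (n - d)).card := by
  set ρ := (nodeAt hd i : ℕ) % (n - d) with hρ
  have hρm : ρ < n - d := Nat.mod_lt _ (by omega)
  by_contra! hle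
  have hfib : ∀ B : Finset (Fin n), B.card =
      ∑ q ∈ Finset.range n, (B.filter fun w : Fin n => (w : ℕ) / (n - d) = q).card := fun B =>
    Finset.card_eq_sum_card_fiberwise fun w _ =>
      Finset.mem_coe.2 (Finset.mem_range.2 ((Nat.div_le_self _ _).trans_lt w.2))
  have hcard := card_filter_mod_lt_row_le hd i
  rw [← hρ, hfib] at hcard
  have : A.card ≤ i := by
    rw [hfib]
    refine (Finset.sum_le_sum fun q _ => ?_).trans hcard
    -- Column by column: one reaching row `ρ` has `ρ` nodes in earlier rows, while a shorter one
    -- lies entirely in those rows.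
    by_cases hq : ∃ v₀ : Fin n, (v₀ : ℕ) / (n - d) = q ∧ ρ ≤ (v₀ : ℕ) % (n - d)
    · obtain ⟨v₀, rfl, hv₀⟩ := hq
      have h1 : (A.filter fun w : Fin n => (w : ℕ) / (n - d) = (v₀ : ℕ) / (n - d)).card ≤ ρ := by
        rcases (A.filter fun w : Fin n =>
          (w : ℕ) / (n - d) = (v₀ : ℕ) / (n - d)).eq_empty_or_nonempty with he | ⟨v, hv⟩
        · simp [he]
        · obtain ⟨hv1, hv2⟩ := Finset.mem_filter.1 hv
          rw [← hv2]
          exact hle v hv1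
      refine h1.trans ?_
      have h4 := Nat.div_add_mod' (v₀ : ℕ) (n - d)
      have hlt : ∀ t ∈ Finset.range ρ, (v₀ : ℕ) / (n - d) * (n - d) + t < n := by
        intro t ht
        have := Finset.mem_range.1 ht
        omega
      refine le_of_eq_of_le (Finset.card_range ρ).symm (Finset.card_le_card_of_injOn
        (fun t => if h : (v₀ : ℕ) / (n - d) * (n - d) + t < n then ⟨_, h⟩ else v₀) ?_ ?_)
      · intro t ht
        have ht' : t < ρ := Finset.mem_range.1 ht
        simp only [hlt t ht, dif_pos, Finset.coe_filter, Finset.mem_filter, Finset.mem_univ,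
          true_and, Set.mem_ofPred_eq]
        have := mul_add_mod_and_div (col := (v₀ : ℕ) / (n - d)) (ht'.trans hρm)
        exact ⟨this.1.trans_lt ht', this.2⟩
      · intro t ht t' ht' e
        simp only [hlt t ht, hlt t' ht', dif_pos, Fin.mk.injEq] at e
        omega
    · push Not at hq
      refine Finset.card_le_card fun w hw => ?_
      obtain ⟨-, hw⟩ := Finset.mem_filter.1 hw
      simp [hw, hq w hw]
  omega

/-- The number of pairs of nodes of `A` from different families, each pair being counted only if
`τ` separates it. -/
def crossPairs (n d : ℕ) (τ : Fin n → ℕ) (A : Finset (Fin n)) : ℕ :=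
  ∑ a ∈ A, (A.filter fun w : Fin n =>
    τ w < τ a ∧ (w : ℕ) / (n - d) ≠ (a : ℕ) / (n - d)).card

/-- A pair containing `v` is counted at only one of its ends, and not at all if `τ` ties. -/
theorem crossPairs_insert_le (n d : ℕ) (τ : Fin n → ℕ) {A : Finset (Fin n)} {v : Fin n}
    (hv : v ∉ A) :
    crossPairs n d τ (insert v A) ≤ crossPairs n d τ A +
      (A.filter fun w : Fin n => (w : ℕ) / (n - d) ≠ (v : ℕ) / (n - d)).card := by
  unfold crossPairs
  simp only [Finset.card_filter, Finset.sum_insert hv, lt_irrefl, false_and, if_false, zero_add,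
    Finset.sum_add_distrib]
  rw [← add_assoc, ← Finset.sum_add_distrib, add_comm (∑ a ∈ A, ∑ b ∈ A, _)]
  refine Nat.add_le_add_right (Finset.sum_le_sum fun w _ => ?_) _
  split_ifs <;> grind

theorem crossPairs_le_sum_yCount (hd : d < n) (τ : Fin n → ℕ) (A : Finset (Fin n)) :
    crossPairs n d τ A ≤ ∑ i ∈ Finset.range A.card, yCount (rfip n d) i := by
  induction hk : A.card generalizing A with
  | zero =>
    obtain rfl := Finset.card_eq_zero.1 hk
    simp [crossPairs]
  | succ k ih =>
    have hkn : k < n := by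
      have := A.card_le_univ
      rw [Fintype.card_fin] at this
      omega
    obtain ⟨v, hv, hrow⟩ := exists_family_gt_row hd (i := ⟨k, hkn⟩) hk
    have h1 := crossPairs_insert_le n d τ (Finset.notMem_erase v A)
    rw [Finset.insert_erase hv] at h1
    have h2 := ih (A.erase v) (by rw [Finset.card_erase_of_mem hv, hk]; rfl)
    have h3 := le_yCount_add_row hd ⟨k, hkn⟩
    have h4 := Finset.card_filter_add_card_filter_not (s := A)
      (fun w : Fin n => (w : ℕ) / (n - d) = (v : ℕ) / (n - d))
    have h5 : ((A.erase v).filter fun w : Fin n => (w : ℕ) / (n - d) ≠ (v : ℕ) / (n - d)).card ≤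
        (A.filter fun w : Fin n => ¬ (w : ℕ) / (n - d) = (v : ℕ) / (n - d)).card :=
      Finset.card_le_card (Finset.filter_subset_filter _ (Finset.erase_subset _ _))
    rw [Finset.sum_range_succ]
    simp only at h3
    omega

theorem fileSize_add_sum_yCount (hd : d < n) {k : ℕ} (hk : k ≤ n) :
    fileSize n k d + ∑ i ∈ Finset.range k, yCount (rfip n d) i = k * d := by
  unfold fileSize
  rw [← Finset.sum_add_distrib, Finset.sum_congr rfl (g := fun _ => d)]
  · simp
  · intro i hi
    rw [Finset.mem_range] at hi
    exact Nat.sub_add_cancel (yCount_le hd ⟨i, by omega⟩)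

theorem fileSize_add_crossPairs_le (hd : d < n) (τ : Fin n → ℕ) (A : Finset (Fin n)) :
    fileSize n A.card d + crossPairs n d τ A ≤ A.card * d := by
  rw [← fileSize_add_sum_yCount hd (by simpa using A.card_le_univ)]
  exact Nat.add_le_add_left (crossPairs_le_sum_yCount hd τ A) _

theorem fileSize_mono (n d : ℕ) {k k' : ℕ} (h : k ≤ k') : fileSize n k d ≤ fileSize n k' d :=
  Finset.sum_le_sum_of_subset (Finset.range_mono h)

end Extremal

/-! ### Counting the packets of `k` nodes -/

section Count

variable {n d : ℕ}

theorem mem_incomplete_iff (hd : d < n) {u : Fin n} :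
    u ∈ incomplete n d ↔ numComplete n d * (n - d) ≤ (u : ℕ) := by
  simp [incomplete, familyIndex_eq_zero_iff hd]

theorem mem_storedIn_iff (hd : d < n) {S : Finset (Fin n)} {e : Sym2 (Fin n)} :
    e ∈ storedIn n d S ↔ ∃ i ∈ S, ∃ j ∈ helpers n d i, s(i, j) = e := by
  simp [storedIn, storedAt_eq hd]

theorem incomplete_subset_helpers (hd : d < n) {i : Fin n} (hi : i ∉ incomplete n d) :
    incomplete n d ⊆ helpers n d i := by
  intro u hu
  rw [mem_incomplete_iff hd] at hi hu
  rw [mem_helpers_iff hd]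
  have h1 := div_eq_numComplete_iff hd i.2
  have h2 := div_eq_numComplete_iff hd u.2
  omega

/-- The number of stored packets that belong to no node of the incomplete family. -/
theorem le_card_storedIn_complete (hd : d < n) (S : Finset (Fin n)) :
    (S \ incomplete n d).card * d ≤
      ((storedIn n d S).filter fun e => ∀ u ∈ incomplete n d, u ∉ e).card +
        crossPairs n d Fin.val (S \ incomplete n d) +
        (S \ incomplete n d).card * (incomplete n d).card := by
  set A := S \ incomplete n d with hA
  -- An edge inside `A` is kept only at its smaller end, which makes the map to edges injective.
  let H : Fin n → Finset (Fin n) := fun i =>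
    (helpers n d i).filter fun j => j ∉ incomplete n d ∧ ¬ (j ∈ A ∧ j < i)
  have h1 : (A.sigma H).card ≤
      ((storedIn n d S).filter fun e => ∀ u ∈ incomplete n d, u ∉ e).card := by
    refine Finset.card_le_card_of_injOn (fun p => s(p.1, p.2)) ?_ ?_
    · rintro ⟨i, j⟩ hp
      simp only [Finset.coe_sigma, Set.mem_sigma_iff, Finset.mem_coe, H, Finset.mem_filter] at hp
      obtain ⟨hi, hj, hj', -⟩ := hp
      rw [hA, Finset.mem_sdiff] at hi
      simp only [Finset.coe_filter, Set.mem_ofPred_eq, mem_storedIn_iff hd, Sym2.mem_iff]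
      refine ⟨⟨i, hi.1, j, hj, rfl⟩, ?_⟩
      rintro u hu (rfl | rfl)
      · exact hi.2 hu
      · exact hj' hu
    · rintro ⟨i, j⟩ hp ⟨i', j'⟩ hp' e
      simp only [Finset.coe_sigma, Set.mem_sigma_iff, Finset.mem_coe, H, Finset.mem_filter]
        at hp hp'
      rcases Sym2.eq_iff.1 e with ⟨rfl, rfl⟩ | ⟨rfl, rfl⟩
      · rfl
      · obtain ⟨hi, hj, -, hlt⟩ := hp
        obtain ⟨hi', -, -, hlt'⟩ := hp'
        have hne : i ≠ j := fun h => self_notMem_helpers hd i (by rwa [← h] at hj)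
        rcases lt_or_gt_of_ne hne with h | h
        · exact absurd ⟨hi, h⟩ hlt'
        · exact absurd ⟨hi', h⟩ hlt
  rw [Finset.card_sigma] at h1
  have h2 : ∀ i ∈ A, d ≤ (H i).card + (A.filter fun w : Fin n =>
      (w : ℕ) < i ∧ (w : ℕ) / (n - d) ≠ (i : ℕ) / (n - d)).card + (incomplete n d).card := by
    intro i hi
    refine le_of_eq_of_le (card_helpers hd i).symm ((Finset.card_le_card (t := H i ∪
      (A.filter fun w : Fin n =>
      (w : ℕ) < i ∧ (w : ℕ) / (n - d) ≠ (i : ℕ) / (n - d)) ∪ incomplete n d) ?_).trans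
      ((Finset.card_union_le _ _).trans (Nat.add_le_add_right (Finset.card_union_le _ _) _)))
    intro j hj
    have := ((mem_helpers_iff hd).1 hj).1
    simp only [Finset.mem_union, Finset.mem_filter, H, Fin.lt_def]
    tauto
  have h3 := Finset.sum_le_sum h2
  simp only [Finset.sum_add_distrib, Finset.sum_const, smul_eq_mul] at h3
  unfold crossPairs
  omega

theorem le_sum_incomplete (hd : d < n) (S : Finset (Fin n)) :
    (incomplete n d ∩ S).card * d +
        (incomplete n d \ S).card * min (S \ incomplete n d).card d ≤
      ∑ u ∈ incomplete n d, min ((storedIn n d S).filter fun e => u ∈ e).card d := by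
  rw [← Finset.sum_inter_add_sum_sdiff (incomplete n d) S]
  refine Nat.add_le_add ?_ ?_
  · rw [← smul_eq_mul]
    refine Finset.card_nsmul_le_sum _ _ _ fun u hu => le_min ?_ le_rfl
    obtain ⟨-, hu⟩ := Finset.mem_inter.1 hu
    refine le_of_eq_of_le (card_storedAt hd u).symm (Finset.card_le_card fun e he => ?_)
    refine Finset.mem_filter.2 ⟨Finset.mem_biUnion.2 ⟨u, hu, he⟩, ?_⟩
    rw [storedAt_eq hd, Finset.mem_image] at he
    obtain ⟨j, -, rfl⟩ := he
    exact Sym2.mem_mk_left _ _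
  · rw [← smul_eq_mul]
    refine Finset.card_nsmul_le_sum _ _ _ fun u hu => min_le_min_right _ ?_
    obtain ⟨hu, -⟩ := Finset.mem_sdiff.1 hu
    refine Finset.card_le_card_of_injOn (fun i => s(u, i)) ?_
      (fun a _ b _ h => Sym2.congr_right.1 h)
    intro i hi
    obtain ⟨hi, hi'⟩ := Finset.mem_sdiff.1 hi
    refine Finset.mem_coe.2 (Finset.mem_filter.2 ⟨?_, Sym2.mem_mk_left _ _⟩)
    exact (mem_storedIn_iff hd).2 ⟨i, hi, u, incomplete_subset_helpers hd hi' hu, Sym2.eq_swap⟩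

/-- The nodes of `N₀` carry the largest numbers and form one family, so every complete node of `S`
is paired with every node of `N₀ ∩ S`. -/
theorem crossPairs_sdiff_add_le (hd : d < n) (S : Finset (Fin n)) :
    crossPairs n d Fin.val (S \ incomplete n d) +
        (incomplete n d ∩ S).card * (S \ incomplete n d).card ≤ crossPairs n d Fin.val S := by
  unfold crossPairs
  rw [← Finset.sum_inter_add_sum_sdiff S (incomplete n d), add_comm, Finset.inter_comm]
  refine Nat.add_le_add ?_ (Finset.sum_le_sum fun a _ =>
    Finset.card_le_card (Finset.filter_subset_filter _ Finset.sdiff_subset))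
  rw [← smul_eq_mul]
  refine Finset.card_nsmul_le_sum _ _ _ fun u hu => Finset.card_le_card fun i hi => ?_
  obtain ⟨hi, hi'⟩ := Finset.mem_sdiff.1 hi
  have hu := (Finset.mem_inter.1 hu).2
  rw [mem_incomplete_iff hd] at hu hi'
  have h1 := div_eq_numComplete_iff hd i.2
  have h2 := div_eq_numComplete_iff hd u.2
  exact Finset.mem_filter.2 ⟨hi, by omega, by omega⟩

theorem fileSize_le_aCount (hd : d < n) (S : Finset (Fin n)) :
    fileSize n S.card d ≤ aCount n d (storedIn n d S) := by
  have h1 := le_card_storedIn_complete hd S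
  have h2 := le_sum_incomplete hd S
  have hZ := Finset.card_inter_add_card_sdiff (incomplete n d) S
  unfold aCount
  rcases le_total (S \ incomplete n d).card d with hs | hs
  · have h3 := crossPairs_sdiff_add_le hd S
    have h4 := fileSize_add_crossPairs_le hd Fin.val S
    have hS := Finset.card_inter_add_card_sdiff S (incomplete n d)
    rw [Finset.inter_comm] at hS
    rw [min_eq_left hs] at h2
    rw [← hZ] at h1
    rw [← hS] at h4 ⊢
    nlinarith
  -- Now every node of `N₀` contributes `d`, as if it belonged to `S`; the bound for `S ∪ N₀` and
  -- monotonicity of the file size suffice.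
  · have hS : (S ∪ incomplete n d) \ incomplete n d = S \ incomplete n d :=
      Finset.union_sdiff_right _ _
    have h3 := crossPairs_sdiff_add_le hd (S ∪ incomplete n d)
    have h4 := fileSize_add_crossPairs_le hd Fin.val (S ∪ incomplete n d)
    have h5 := fileSize_mono n d (Finset.card_le_card (Finset.subset_union_left (s₁ := S)
      (s₂ := incomplete n d)))
    have hc : (S ∪ incomplete n d).card = (S \ incomplete n d).card + (incomplete n d).card := by
      rw [← Finset.card_sdiff_add_card]
    rw [hS, Finset.inter_eq_left.2 Finset.subset_union_right] at h3
    rw [min_eq_right hs] at h2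
    rw [hc] at h4 h5
    rw [← hZ] at h1 h3 h4 h5
    nlinarith

theorem canReconstruct_storedIn (hd : d < n) {F : Type*} [Field F] {k : ℕ} (C : Code F n k d)
    {S : Finset (Fin n)} (hS : S.card = k) : CanReconstruct C.coding (storedIn n d S) :=
  C.property_two _ (storedIn_subset_edges n d S) (hS ▸ fileSize_le_aCount hd S)

end Count

/-! ### Cuts of information flow graphs -/

section Flow

variable {n d T : ℕ}

theorem exists_isActive (h : Fin T → Fin n) {t : ℕ} (ht : t ≤ T) (j : Fin n) :
    ∃ a : Incarnation n T, nodeOf h a = j ∧ IsActive h t a := by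
  induction t with
  | zero => exact ⟨.inl j, rfl, le_rfl, fun s _ hs => absurd hs (Nat.not_lt_zero _)⟩
  | succ t ih =>
    by_cases hj : h ⟨t, ht⟩ = j
    · exact ⟨.inr ⟨t, ht⟩, hj, le_rfl, fun s hs hs' => by simp only [birth] at hs; omega⟩
    · obtain ⟨a, rfl, ha, ha'⟩ := ih (by omega)
      refine ⟨a, rfl, by omega, fun s hs hs' => ?_⟩
      by_cases hst : (s : ℕ) = t
      · obtain rfl : s = ⟨t, ht⟩ := Fin.ext hst
        exact hj
      · exact ha' s hs (by omega)

/-- In a cut of finite capacity, the edges into one of the two vertices of an incarnation whose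
output lies on the sink side carry at least as much as the helpers on the source side. -/
theorem exists_inflow_ge (hd : d < n) (h : Fin T → Fin n) (S : Finset (Fin n))
    {U : Finset (Vertex n T)} (hU : ∀ i : Fin n, Vertex.inp (.inl i) ∈ U)
    {A : Finset (Fin n)} {τ : Fin n → ℕ}
    (hA : ∀ b, Vertex.out b ∉ U → nodeOf h b ∈ A ∧ τ (nodeOf h b) ≤ birth b)
    {a : Incarnation n T} (ha : Vertex.out a ∉ U) :
    ∃ v ∈ ({Vertex.inp a, Vertex.out a} : Finset (Vertex n T)), v ∉ U ∧
      (d : ℝ≥0∞) ≤ ∑ u ∈ U, capacity (helpers n d) d 1 h S u v +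
        ((A.filter fun w : Fin n => τ w < birth a ∧
          (w : ℕ) / (n - d) ≠ (nodeOf h a : ℕ) / (n - d)).card : ℝ≥0∞) := by
  by_cases hin : Vertex.inp a ∈ U
  · refine ⟨.out a, by simp, ha, le_add_right ?_⟩
    refine le_trans ?_ (Finset.single_le_sum (fun _ _ => zero_le) hin)
    simp [capacity]
  · obtain i | t := a
    · exact absurd (hU i) hin
    refine ⟨.inp (.inr t), by simp, hin, ?_⟩
    choose b hb hb' using exists_isActive h t.2.le
    have hbinj : Function.Injective b := fun i j e => by rw [← hb i, e, hb j]
    let B := (helpers n d (h t)).filter fun w => Vertex.out (b w) ∈ U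
    have h1 : (B.card : ℝ≥0∞) ≤
        ∑ u ∈ U, capacity (helpers n d) d 1 h S u (.inp (.inr t)) := by
      rw [Finset.cast_card]
      calc ∑ w ∈ B, (1 : ℝ≥0∞)
          = ∑ w ∈ B, capacity (helpers n d) d 1 h S (.out (b w)) (.inp (.inr t)) := by
            refine Finset.sum_congr rfl fun w hw => ?_
            simp [capacity, hb, hb', (Finset.mem_filter.1 hw).1]
        _ = ∑ u ∈ B.image fun w => Vertex.out (b w),
              capacity (helpers n d) d 1 h S u (.inp (.inr t)) := by
            rw [Finset.sum_image]
            intro x _ y _ e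
            exact hbinj (by simpa using e)
        _ ≤ _ := by
            refine Finset.sum_le_sum_of_subset fun u hu => ?_
            obtain ⟨w, hw, rfl⟩ := Finset.mem_image.1 hu
            exact (Finset.mem_filter.1 hw).2
    have h2 : d ≤ B.card + (A.filter fun w : Fin n => τ w < birth (.inr t : Incarnation n T) ∧
          (w : ℕ) / (n - d) ≠ (h t : ℕ) / (n - d)).card := by
      refine le_of_eq_of_le (card_helpers hd (h t)).symm
        ((Finset.card_le_card fun w hw => ?_).trans (Finset.card_union_le _ _))
      by_cases hw' : Vertex.out (b w) ∈ U
      · exact Finset.mem_union_left _ (Finset.mem_filter.2 ⟨hw, hw'⟩)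
      -- A helper on the sink side was born by time `t`, strictly before the newcomer with birth `t
      -- + 1`, and lies in another family.
      · have h3 := hA _ hw'
        have h4 := (hb' w).1
        rw [hb] at h3
        refine Finset.mem_union_right _ (Finset.mem_filter.2 ⟨h3.1, ?_, ?_⟩)
        · simp only [birth]; omega
        · exact ((mem_helpers_iff hd).1 hw).1
    calc (d : ℝ≥0∞) ≤ _ := Nat.cast_le.2 h2
      _ ≤ _ := by
        rw [Nat.cast_add]
        exact add_le_add_left h1 _

theorem supports_fileSize (hd : d < n) (k : ℕ) : Supports n k d (fileSize n k d) d 1 := by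
  intro T h S hS
  rw [minCut]
  refine le_iInf fun U => le_iInf fun hsrc => le_iInf fun hsink => ?_
  simp only [ENNReal.coe_natCast, ENNReal.coe_one]
  have edge : ∀ {u v}, u ∈ U → v ∉ U → capacity (helpers n d) d 1 h S u v ≤
      ∑ u ∈ U, ∑ v ∈ Uᶜ, capacity (helpers n d) d 1 h S u v := fun {u v} hu hv =>
    (Finset.single_le_sum (f := fun v => capacity (helpers n d) d 1 h S u v)
      (fun _ _ => zero_le) (Finset.mem_compl.2 hv)).trans
    (Finset.single_le_sum (f := fun u => ∑ v ∈ Uᶜ, capacity (helpers n d) d 1 h S u v)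
      (fun _ _ => zero_le) hu)
  by_cases hU : ∀ i : Fin n, Vertex.inp (.inl i) ∈ U
  swap
  · push Not at hU
    obtain ⟨i, hi⟩ := hU
    exact le_top.trans (edge hsrc hi)
  by_cases hout : ∃ a, Vertex.out a ∈ U ∧ nodeOf h a ∈ S ∧ IsActive h T a
  · obtain ⟨a, haU, ha⟩ := hout
    refine le_top.trans (le_trans (le_of_eq ?_) (edge haU hsink))
    simp [capacity, ha]
  push Not at hout
  classical
  let A : Finset (Fin n) :=
    Finset.univ.filter fun j => ∃ a : Incarnation n T, nodeOf h a = j ∧ Vertex.out a ∉ U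
  have hSA : S ⊆ A := by
    intro j hj
    obtain ⟨a, rfl, ha⟩ := exists_isActive h le_rfl j
    exact Finset.mem_filter.2 ⟨Finset.mem_univ _, a, rfl, fun hU => hout a hU hj ha⟩
  -- The earliest incarnation of `j` with output on the sink side; its value for `j ∉ A` is
  -- arbitrary.
  have hmin : ∀ j : Fin n, ∃ a : Incarnation n T, j ∈ A → nodeOf h a = j ∧ Vertex.out a ∉ U ∧
      ∀ b, nodeOf h b = j → Vertex.out b ∉ U → birth a ≤ birth b := by
    intro j
    by_cases hj : j ∈ A
    · have hne : (Finset.univ.filter fun a : Incarnation n T =>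
          nodeOf h a = j ∧ Vertex.out a ∉ U).Nonempty := by
        obtain ⟨a, ha⟩ := (Finset.mem_filter.1 hj).2
        exact ⟨a, by simpa using ha⟩
      obtain ⟨a, ha, ha'⟩ := Finset.exists_min_image _ birth hne
      obtain ⟨ha1, ha2⟩ := (Finset.mem_filter.1 ha).2
      exact ⟨a, fun _ => ⟨ha1, ha2, fun b hb hb' => ha' b (by simp [hb, hb'])⟩⟩
    · exact ⟨.inl j, fun h => absurd h hj⟩
  choose first hfirst using hmin
  have hA : ∀ b, Vertex.out b ∉ U →
      nodeOf h b ∈ A ∧ birth (first (nodeOf h b)) ≤ birth b := by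
    intro b hb
    have hbA : nodeOf h b ∈ A := Finset.mem_filter.2 ⟨Finset.mem_univ _, b, rfl, hb⟩
    exact ⟨hbA, (hfirst _ hbA).2.2 b rfl hb⟩
  have htarget : ∀ j : Fin n, ∃ v : Vertex n T, j ∈ A →
      v ∈ ({Vertex.inp (first j), Vertex.out (first j)} : Finset (Vertex n T)) ∧ v ∉ U ∧
      (d : ℝ≥0∞) ≤ ∑ u ∈ U, capacity (helpers n d) d 1 h S u v +
        ((A.filter fun w : Fin n => birth (first w) < birth (first j) ∧
          (w : ℕ) / (n - d) ≠ (j : ℕ) / (n - d)).card : ℝ≥0∞) := by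
    intro j
    by_cases hj : j ∈ A
    · obtain ⟨v, hv⟩ := exists_inflow_ge hd h S hU (τ := fun w => birth (first w)) hA
        (hfirst j hj).2.1
      rw [(hfirst j hj).1] at hv
      exact ⟨v, fun _ => hv⟩
    · exact ⟨.source, fun h => absurd h hj⟩
  choose target htarget using htarget
  -- A target determines its incarnation and hence its node, so the inflows add up without overlap.
  have hinj : Set.InjOn target A := by
    intro i hi j hj e
    have h1 := (htarget i hi).1
    have h2 := (htarget j hj).1
    rw [e] at h1
    have h3 : first i = first j := by
      simp only [Finset.mem_insert, Finset.mem_singleton] at h1 h2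
      grind
    rw [← (hfirst i hi).1, h3, (hfirst j hj).1]
  have hcut : ((A.card * d : ℕ) : ℝ≥0∞) ≤ ∑ u ∈ U, ∑ v ∈ Uᶜ, capacity (helpers n d) d 1 h S u v +
      (crossPairs n d (fun w => birth (first w)) A : ℕ) := by
    calc ((A.card * d : ℕ) : ℝ≥0∞) = ∑ j ∈ A, (d : ℝ≥0∞) := by simp
      _ ≤ ∑ j ∈ A, (∑ u ∈ U, capacity (helpers n d) d 1 h S u (target j) +
            ((A.filter fun w : Fin n => birth (first w) < birth (first j) ∧
              (w : ℕ) / (n - d) ≠ (j : ℕ) / (n - d)).card : ℝ≥0∞)) :=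
          Finset.sum_le_sum fun j hj => (htarget j hj).2.2
      _ = ∑ v ∈ A.image target, ∑ u ∈ U, capacity (helpers n d) d 1 h S u v +
            (crossPairs n d (fun w => birth (first w)) A : ℕ) := by
          rw [Finset.sum_add_distrib, Finset.sum_image hinj, crossPairs, Nat.cast_sum]
      _ ≤ _ := by
          rw [Finset.sum_comm (s := U)]
          refine add_le_add_left (Finset.sum_le_sum_of_subset fun v hv => ?_) _
          obtain ⟨j, hj, rfl⟩ := Finset.mem_image.1 hv
          exact Finset.mem_compl.2 (htarget j hj).2.1
  have hsize := fileSize_add_crossPairs_le hd (fun w => birth (first w)) A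
  have hmono := fileSize_mono n d (Finset.card_le_card hSA)
  rw [hS] at hmono
  refine (Nat.cast_le.2 hmono).trans ?_
  have := (Nat.cast_le (α := ℝ≥0∞).2 hsize).trans hcut
  rw [Nat.cast_add] at this
  exact (ENNReal.add_le_add_iff_right (ENNReal.natCast_ne_top _)).1 this

/-- The bound from the cut whose sink side consists of the newcomers, except for the inputs of the
newcomers in `X`. -/
theorem minCut_le (D : Fin n → Finset (Fin n)) (α β : ℝ≥0∞) {h : Fin T → Fin n}
    (X : Finset (Fin T)) :
    minCut D α β h (Finset.univ.image h) ≤ X.card * α + ∑ t ∈ Xᶜ,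
      ((D (h t)).filter fun w => ∀ s : Fin T, s < t → h s ≠ w).card * β := by
  let U : Finset (Vertex n T) := {Vertex.source} ∪
    (Finset.univ.image fun i : Fin n => Vertex.inp (.inl i)) ∪
    (Finset.univ.image fun i : Fin n => Vertex.out (.inl i)) ∪
    X.image fun t => Vertex.inp (.inr t)
  have hUc : Uᶜ = {Vertex.sink} ∪ (Finset.univ.image fun t : Fin T => Vertex.out (.inr t)) ∪
      Xᶜ.image fun t => Vertex.inp (.inr t) := by
    ext v
    rcases v with _ | (i | t) | (i | t) | _ <;> simp [U]
  have hle : minCut D α β h (Finset.univ.image h) ≤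
      ∑ u ∈ U, ∑ v ∈ Uᶜ, capacity D α β h (Finset.univ.image h) u v :=
    (iInf_le _ U).trans ((iInf_le _ (by simp [U])).trans (iInf_le _ (by simp [U])))
  refine hle.trans ?_
  have hcol : ∀ v, ∑ u ∈ U, capacity D α β h (Finset.univ.image h) u v ≤
      capacity D α β h (Finset.univ.image h) .source v +
      ∑ i, capacity D α β h (Finset.univ.image h) (.inp (.inl i)) v +
      ∑ i, capacity D α β h (Finset.univ.image h) (.out (.inl i)) v +
      ∑ t ∈ X, capacity D α β h (Finset.univ.image h) (.inp (.inr t)) v := by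
    intro v
    have hun : ∀ P Q : Finset (Vertex n T), ∑ u ∈ P ∪ Q, capacity D α β h (Finset.univ.image h) u v ≤
        ∑ u ∈ P, capacity D α β h (Finset.univ.image h) u v +
        ∑ u ∈ Q, capacity D α β h (Finset.univ.image h) u v := fun P Q => by
      rw [← Finset.sum_union_inter]; exact le_self_add
    have himg : ∀ {ι : Type} [Fintype ι] (P : Finset ι) (f : ι → Vertex n T), f.Injective →
        ∑ u ∈ P.image f, capacity D α β h (Finset.univ.image h) u v =
        ∑ i ∈ P, capacity D α β h (Finset.univ.image h) (f i) v := fun P f hf =>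
      Finset.sum_image hf.injOn
    refine (hun _ _).trans (add_le_add ((hun _ _).trans (add_le_add ((hun _ _).trans
      (add_le_add ?_ ?_)) ?_)) ?_)
    · simp
    · exact (himg _ _ fun a b e => by simpa using e).le
    · exact (himg _ _ fun a b e => by simpa using e).le
    · exact (himg _ _ fun a b e => by simpa using e).le
  have hinactive : ∀ i : Fin n, i ∈ Finset.univ.image h →
      ¬ IsActive h T (.inl i : Incarnation n T) := by
    rintro i hi ⟨-, hact⟩
    obtain ⟨t, -, rfl⟩ := Finset.mem_image.1 hi
    exact hact t (Nat.zero_le _) t.2 rfl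
  rw [Finset.sum_comm, hUc, Finset.sum_union, Finset.sum_union, Finset.sum_image,
    Finset.sum_image, Finset.sum_singleton]
  rotate_left
  · intro a _ b _ e; simpa using e
  · intro a _ b _ e; simpa using e
  · simp
  · rw [Finset.disjoint_left]; simp
  refine add_le_add ((add_le_add (hcol _) (Finset.sum_le_sum fun t _ => hcol _)).trans ?_)
    (Finset.sum_le_sum fun t ht => (hcol _).trans ?_)
  -- Every node of the collector has failed, so no infinite edge leaves an initial incarnation for
  -- the sink.
  · have hz : ∀ i : Fin n, ¬ ((∃ t, h t = i) ∧ IsActive h T (.inl i : Incarnation n T)) := by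
      rintro i ⟨⟨t, ht⟩, hact⟩
      exact hinactive i (Finset.mem_image.2 ⟨t, Finset.mem_univ _, ht⟩) hact
    simp [capacity, nodeOf, hz]
  · have hact : ∀ i : Fin n, IsActive h t (.inl i : Incarnation n T) ↔
        ∀ s : Fin T, s < t → h s ≠ i := fun i => by simp [IsActive, birth, nodeOf]
    simp only [capacity, nodeOf, hact, Finset.sum_const_zero, zero_add, add_zero]
    rw [← Finset.sum_filter, Finset.sum_const, nsmul_eq_mul]
    refine mul_le_mul_left (Nat.cast_le.2 (Finset.card_le_card fun i hi => ?_)) _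
    simpa using hi

end Flow

/-! ### The tight failure history and optimality -/

section TightHistory

variable {n k d : ℕ}

/-- The failure history in which the first `k` nodes of the reading order fail one by one. -/
def tightHistory (hd : d < n) (hk : k ≤ n) (t : Fin k) : Fin n := nodeAt hd (Fin.castLE hk t)

theorem card_fresh_helpers (hd : d < n) (hk : k ≤ n) (t : Fin k) :
    ((helpers n d (tightHistory hd hk t)).filter fun w =>
      ∀ s : Fin k, s < t → tightHistory hd hk s ≠ w).card = d - yCount (rfip n d) t := by
  have h1 := Finset.card_filter_add_card_filter_not (s := helpers n d (tightHistory hd hk t))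
    (fun w => ∀ s : Fin k, s < t → tightHistory hd hk s ≠ w)
  have h2 : ((helpers n d (tightHistory hd hk t)).filter fun w =>
      ¬ ∀ s : Fin k, s < t → tightHistory hd hk s ≠ w) =
      (Finset.univ.filter fun j => j < Fin.castLE hk t ∧
        nodeAt hd j ∈ helpers n d (nodeAt hd (Fin.castLE hk t))).image (nodeAt hd) := by
    ext w
    simp only [Finset.mem_filter, Finset.mem_image, Finset.mem_univ, true_and]
    simp only [tightHistory]
    constructor
    · rintro ⟨hw, hw'⟩
      push Not at hw'
      obtain ⟨s, hs, rfl⟩ := hw'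
      exact ⟨Fin.castLE hk s, ⟨hs, hw⟩, rfl⟩
    · rintro ⟨j, ⟨hj, hj'⟩, rfl⟩
      have : (j : ℕ) < t := hj
      exact ⟨hj', fun h => h ⟨j, by omega⟩ this rfl⟩
  have h3 := yCount_rfip hd (Fin.castLE hk t)
  rw [card_helpers hd, h2, Finset.card_image_of_injective _ (nodeAt_injective hd), ← h3] at h1
  exact Nat.eq_sub_of_add_eq h1

theorem fileSize_eq_sum_fin (n k d : ℕ) :
    fileSize n k d = ∑ t : Fin k, (d - yCount (rfip n d) t) :=
  Finset.sum_range _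

theorem fileSize_le_of_supports (hd : d < n) (hk : k ≤ n) {M : ℕ} {α β : ℝ≥0}
    (hsup : Supports n k d M α β) (X : Finset (Fin k)) :
    (M : ℝ≥0) ≤ X.card * α + ∑ t ∈ Xᶜ, ((d - yCount (rfip n d) t : ℕ) : ℝ≥0) * β := by
  have hinj : Function.Injective (tightHistory hd hk) :=
    (nodeAt_injective hd).comp (Fin.castLE_injective hk)
  have h1 := (hsup k (tightHistory hd hk) (Finset.univ.image (tightHistory hd hk))
    (by rw [Finset.card_image_of_injective _ hinj]; simp)).trans (minCut_le _ _ _ X)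
  simp only [card_fresh_helpers] at h1
  exact_mod_cast h1

/-- In the tight history, `X = ∅` gives `M ≤ M * β`. With `β = 1`, moving the first newcomer's input
to the source side replaces its term `d - y = d` by `α`, so `α ≥ d`. -/
theorem isMBRPoint (hd : d < n) (hd0 : 1 ≤ d) (hk0 : 1 ≤ k) (hk : k ≤ n) :
    IsMBRPoint n k d (fileSize n k d) d 1 := by
  refine ⟨by exact_mod_cast supports_fileSize hd k, fun α β hsup => ⟨?_, ?_⟩⟩
  · have h1 := fileSize_le_of_supports hd hk hsup ∅
    rw [Finset.compl_empty, ← Finset.sum_mul, ← Nat.cast_sum, ← fileSize_eq_sum_fin] at h1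
    have hpos : 0 < fileSize n k d := by
      have h2 := fileSize_mono n d hk0
      have h3 : fileSize n 1 d = d := by simp [fileSize, yCount]
      omega
    have hpos' : (0 : ℝ≥0) < fileSize n k d := by exact_mod_cast hpos
    simp only [Finset.card_empty, Nat.cast_zero, zero_mul, zero_add] at h1
    exact (le_mul_iff_one_le_right hpos').1 h1
  · rintro rfl
    have h1 := fileSize_le_of_supports hd hk hsup {⟨0, hk0⟩}
    have h2 := Finset.sum_add_sum_compl ({⟨0, hk0⟩} : Finset (Fin k))
      fun t => d - yCount (rfip n d) t
    rw [← fileSize_eq_sum_fin, Finset.sum_singleton] at h2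
    have h3 : yCount (rfip n d) 0 = 0 := by simp [yCount]
    rw [← h2, h3] at h1
    simpa using h1

end TightHistory

end GFR

theorem proposition10 (n k d : ℕ) (hn : 2 ≤ n) (hk : 1 ≤ k) (hkn : k ≤ n) (hd : 1 ≤ d)
    (hdn : d ≤ n - 1) (F : Type*) [Field F] :
    -- any `k` nodes hold packets whose `a.count` is at least the file size
    (∀ S : Finset (Fin n), S.card = k →
      GFR.fileSize n k d ≤ GFR.aCount n d (GFR.storedIn n d S)) ∧
    -- any `k` nodes can reconstruct the file
    (∀ C : GFR.Code F n k d, ∀ S : Finset (Fin n), S.card = k →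
      GFR.CanReconstruct C.coding (GFR.storedIn n d S)) ∧
    -- exact repair with `α = d`, `β = 1` and the `d` helpers of the family repair scheme
    (∀ C : GFR.Code F n k d, ∀ i : Fin n,
      (GFR.storedAt n d i).card = d ∧ (GFR.helpers n d i).card = d ∧ i ∉ GFR.helpers n d i ∧
        GFR.ExactlyRepairable C i) ∧
    -- `(α, β) = (d, 1)` is the MBR point of the family repair scheme for this file size
    GFR.IsMBRPoint n k d (GFR.fileSize n k d) d 1 := by
  have hlt : d < n := by omega
  refine ⟨fun S hS => hS ▸ GFR.fileSize_le_aCount hlt S,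
    fun C S hS => GFR.canReconstruct_storedIn hlt C hS,
    fun C i => ⟨GFR.card_storedAt hlt i, GFR.card_helpers hlt i, GFR.self_notMem_helpers hlt i,
      GFR.exactlyRepairable hlt C i⟩,
    GFR.isMBRPoint hlt hd hk hkn⟩
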